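/- Consider a search space of $N$ elements, of which $k$ are marked; one marked element $f$ is faulty and the other $k-1$ are not. Grover's algorithm starts in $\frac{1}{\sqrt N}\sum_{i=1}^N|i\rangle$, and each step applies a query and then the diffusion transformation $D$, the $N\times N$ matrix with diagonal entries $-1+\frac2N$ and off-diagonal entries $\frac2N$. The correct query maps $|i\rangle$ to $-|i\rangle$ if $i$ is marked and to $|i\rangle$ otherwise. In each step, independently and with probability $p\in[0,1]$, a fault occurs: the query then leaves $|f\rangle$ unchanged, and acts correctly on all other basis states. There are absolute constants $C,\delta>0$ such that the following holds whenever $k\le\delta N$. 1. If $k\ge 3$, there is a number of steps $t\le C\sqrt{N/k}$, depending only on $N$ and $k$, such that, for every set of $k$ marked elements, every choice of the faulty one and every $p$, running Grover's algorithm for $t$ steps and measuring the final state gives a marked element (faulty or not) with probability at least $\cos^2\frac{\pi}{8}=0.85\ldots$. 2. If $k=2$, there is $t\le C\sqrt{N/2}$, depending only on $N$, such that, under the promise that at most one fault occurs in the $t$ steps, the probability of finding a marked element is at least $\cos^2\frac{\pi}{8}$. This holds for every fixed pattern of faults with at most one fault, and also, for every $p$ for which this event has positive probability, conditionally on at most one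 fault. 3. If $k=2$, there is $t\le C\sqrt{N/2}$, depending only on $N$, such that for every $p$, with no promise on the number of faults, the probability of finding a marked element is at least $\cos^2(0.17\pi)=0.74\ldots$. -/

import Mathlib

open scoped Matrix

/-- The starting state of Grover's algorithm: the uniform superposition over `N` basis states. -/
noncomputable def groverStart (N : ℕ) : Fin N → ℂ :=
  fun _ => ((1 / Real.sqrt N : ℝ) : ℂ)

/-- The diffusion transformation: entries `-1 + 2/N` on the diagonal, `2/N` off the diagonal. -/
noncomputable def groverDiffusion (N : ℕ) : Matrix (Fin N) (Fin N) ℂ :=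
  Matrix.of fun i j => if i = j then -1 + 2 / (N : ℂ) else 2 / (N : ℂ)

/-- The query with marked set `M`: it flips the sign of the marked basis states. -/
def groverQuery {N : ℕ} (M : Finset (Fin N)) : Matrix (Fin N) (Fin N) ℂ :=
  Matrix.diagonal fun i => if i ∈ M then -1 else 1

/-- The query as actually performed when `f` is the faulty element. If `fault` is `true`, the sign
of `f` is not flipped, and all other basis states are treated as by the correct query;
if `fault` is `false`, this is the correct query. -/
def groverFaultyQuery {N : ℕ} (M : Finset (Fin N)) (f : Fin N) (fault : Bool) :
    Matrix (Fin N) (Fin N) ℂ :=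
  if fault then groverQuery (M.erase f) else groverQuery M

/-- The pure state after `t` steps of Grover's algorithm (a query followed by a diffusion), when
the query of step `s` is faulty exactly if `w s` is `true`. -/
noncomputable def groverState {N : ℕ} (M : Finset (Fin N)) (f : Fin N) :
    (t : ℕ) → (Fin t → Bool) → (Fin N → ℂ)
  | 0, _ => groverStart N
  | t + 1, w => groverDiffusion N *ᵥ
      (groverFaultyQuery M f (w (Fin.last t)) *ᵥ groverState M f t fun s => w s.castSucc)

/-- The probability that measuring the state `ψ` in the computational basis gives an element
of `M`. -/
noncomputable def probMeasuredIn {N : ℕ} (M : Finset (Fin N)) (ψ : Fin N → ℂ) : ℝ :=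
  ∑ i ∈ M, ‖ψ i‖ ^ 2

/-- The probability of the fault pattern `w` when every query is faulty with probability `p`,
independently of the others. -/
def faultPatternProb (p : ℝ) {t : ℕ} (w : Fin t → Bool) : ℝ :=
  ∏ s, if w s then p else 1 - p

/-- The number of faults in a fault pattern. -/
def faultCount {t : ℕ} (w : Fin t → Bool) : ℕ :=
  (Finset.univ.filter fun s => w s = true).card

/-- The probability that `t` steps of Grover's algorithm with marked set `M`, whose element `f` is
faulty with probability `p` in each query, followed by a measurement, give a marked element. -/
noncomputable def groverSuccessProb {N : ℕ} (M : Finset (Fin N)) (f : Fin N) (p : ℝ) (t : ℕ) : ℝ :=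
  ∑ w : Fin t → Bool, faultPatternProb p w * probMeasuredIn M (groverState M f t w)

/-- The probability that at most one of `t` queries is faulty. -/
def atMostOneFaultProb (p : ℝ) (t : ℕ) : ℝ :=
  ∑ w : Fin t → Bool with faultCount w ≤ 1, faultPatternProb p w

/-- The probability of finding a marked element, conditional on at most one fault. It is
meaningful only if `0 < atMostOneFaultProb p t`. -/
noncomputable def groverSuccessProbAtMostOneFault {N : ℕ} (M : Finset (Fin N)) (f : Fin N)
    (p : ℝ) (t : ℕ) : ℝ :=
  (∑ w : Fin t → Bool with faultCount w ≤ 1,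
    faultPatternProb p w * probMeasuredIn M (groverState M f t w)) / atMostOneFaultProb p t

/-! By symmetry the state stays in a real three-dimensional space, where a fault is an extra sign
flip of the faulty amplitude. The start lies at angle `φ = arcsin √(k/N)` from the unmarked axis.
The proof bounds the final unmarked amplitude `u` by `|u| ≤ sin (π/8)` for every fault pattern,
hence for every distribution of faults.

From below: whatever the faults, a step increases the angle to the unmarked axis by at most `2φ`, so
`u` cannot become too negative. The same estimate shows that the good amplitude grows at least as
fast as `β sin γ`, with `β = √((k-1)/k)` (`Advanced.rotate`).

From above: cut the `2j` steps in the middle and move the second half to the other side of a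
bilinear form. Then `u = form x y` with `x` and `y` both advanced by `j` steps, and their large good
amplitudes make the form small (`form_le`). Since `β² ≥ 1/2` for `k ≥ 2`, this gives `u ≤ cos²
(2jφ)`. With `2jφ` near `0.29π` both bounds suffice. -/

/-- Real amplitudes of a state that is uniform on the non-faulty marked elements and uniform on the
unmarked elements, in the orthonormal basis of the faulty element and these two uniform
superpositions. -/
structure Amplitudes where
  faulty : ℝ
  good : ℝ
  unmarked : ℝ

/-! ### One step in three real dimensions. -/

namespace Amplitudes

/-- The sign change of the faulty amplitude caused by a fault. -/
def flipFaulty (w : Bool) (x : Amplitudes) : Amplitudes :=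
  ⟨if w then -x.faulty else x.faulty, x.good, x.unmarked⟩

/-- A correct query followed by the reflection about the unit vector `s`. -/
def rotate (s x : Amplitudes) : Amplitudes :=
  let S := s.unmarked * x.unmarked - s.faulty * x.faulty - s.good * x.good
  ⟨x.faulty + 2 * s.faulty * S, x.good + 2 * s.good * S, -x.unmarked + 2 * s.unmarked * S⟩

/-- The amplitudes after `n` steps from `x`, with faults given by `w`. -/
def run (s : Amplitudes) (w : ℕ → Bool) (x : Amplitudes) : ℕ → Amplitudes
  | 0 => x
  | n + 1 => rotate s (flipFaulty (w n) (run s w x n))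

/-- The squared norm. -/
def normSq (x : Amplitudes) : ℝ := x.faulty ^ 2 + x.good ^ 2 + x.unmarked ^ 2

/-- The bilinear form for which `flipFaulty` and `rotate` are self-adjoint. -/
def form (x y : Amplitudes) : ℝ :=
  x.unmarked * y.unmarked - x.good * y.good - x.faulty * y.faulty

/-- Unit vectors within angle `γ` of the unmarked state, whose good amplitude has grown at least as
much as it does in a rotation by `γ`. -/
structure Advanced (β γ : ℝ) (x : Amplitudes) : Prop where
  normSq_eq : x.normSq = 1
  good_ge : β * Real.sin γ ≤ x.good
  unmarked_ge : Real.cos γ ≤ x.unmarked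

theorem run_succ_left (s : Amplitudes) (w : ℕ → Bool) (x : Amplitudes) (n : ℕ) :
    run s w x (n + 1) = run s (fun i => w (i + 1)) (rotate s (flipFaulty (w 0) x)) n := by
  induction n with
  | zero => rfl
  | succ n ih => rw [run, ih]; rfl

theorem run_add (s : Amplitudes) (w : ℕ → Bool) (x : Amplitudes) (j m : ℕ) :
    run s w x (j + m) = run s (fun i => w (j + i)) (run s w x j) m := by
  induction m with
  | zero => rfl
  | succ m ih => rw [← add_assoc, run, ih]; rfl

theorem form_flipFaulty (w : Bool) (x y : Amplitudes) :
    form (flipFaulty w x) y = form x (flipFaulty w y) := by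
  cases w <;> simp [form, flipFaulty]

/-- With `Q` the correct query and `D` the reflection, `form x y = ⟪Q x, y⟫` and `rotate = D Q`; the
operator `Q D Q` is symmetric. -/
theorem form_rotate (s x y : Amplitudes) : form (rotate s x) y = form x (rotate s y) := by
  simp only [form, rotate]; ring

theorem Advanced.flipFaulty {β γ : ℝ} {x : Amplitudes} (h : Advanced β γ x) (w : Bool) :
    Advanced β γ (flipFaulty w x) := by
  refine ⟨?_, h.good_ge, h.unmarked_ge⟩
  rw [← h.normSq_eq]
  cases w <;> simp [normSq, Amplitudes.flipFaulty]

theorem normSq_rotate {s : Amplitudes} (hs : s.normSq = 1) (x : Amplitudes) :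
    (rotate s x).normSq = x.normSq := by
  simp only [normSq, rotate] at *
  linear_combination
    4 * (s.unmarked * x.unmarked - s.faulty * x.faulty - s.good * x.good) ^ 2 * hs

/-- The common factor `S` of the reflection is at least `cos (γ + φ)`, so the good amplitude gains
at least `2β sin φ cos (γ + φ) = β (sin (γ + 2φ) - sin γ)`. -/
theorem Advanced.rotate {β γ φ : ℝ} {s x : Amplitudes} (hx : Advanced β γ x)
    (hs : s.normSq = 1) (hβ : 0 ≤ β) (hφ : 0 ≤ φ) (hsu : s.unmarked = Real.cos φ)
    (hsg : s.good = β * Real.sin φ) (hγ : 0 ≤ γ) (hle : γ + 2 * φ ≤ Real.pi) :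
    Advanced β (γ + 2 * φ) (rotate s x) := by
  obtain ⟨hn, hg, hu⟩ := hx
  have hφπ : φ ≤ Real.pi / 2 := by linarith
  have hsin : 0 ≤ Real.sin φ := Real.sin_nonneg_of_nonneg_of_le_pi hφ (by linarith)
  have hcos : 0 ≤ Real.cos φ := Real.cos_nonneg_of_neg_pi_div_two_le_of_le (by linarith) hφπ
  have hu1 : x.unmarked ≤ 1 := by
    simp only [normSq] at hn
    nlinarith [sq_nonneg x.faulty, sq_nonneg x.good]
  -- The exact angle is needed for the unmarked bound: `x.unmarked` enters the new amplitude with a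
  -- minus sign, so a lower bound on it alone would not do.
  set η := Real.arccos x.unmarked with hη
  have hcosη : Real.cos η = x.unmarked :=
    Real.cos_arccos (by linarith [Real.neg_one_le_cos γ]) hu1
  have hη0 : 0 ≤ η := Real.arccos_nonneg _
  have hηγ : η ≤ γ := by
    rw [hη, ← Real.arccos_cos hγ (by linarith)]
    exact Real.arccos_le_arccos hu
  have hsinη : 0 ≤ Real.sin η := Real.sin_nonneg_of_nonneg_of_le_pi hη0 (by linarith)
  -- Cauchy–Schwarz in the marked plane.
  have hcs : s.faulty * x.faulty + s.good * x.good ≤ Real.sin φ * Real.sin η := by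
    apply abs_le_of_sq_le_sq' _ (by positivity) |>.2
    have h1 : s.faulty ^ 2 + s.good ^ 2 = Real.sin φ ^ 2 := by
      simp only [normSq] at hs
      rw [Real.sin_sq, ← hsu]; linarith
    have h2 : x.faulty ^ 2 + x.good ^ 2 = Real.sin η ^ 2 := by
      simp only [normSq] at hn
      rw [Real.sin_sq, hcosη]; linarith
    rw [mul_pow, ← h1, ← h2]
    nlinarith [sq_nonneg (s.faulty * x.good - s.good * x.faulty)]
  have hS : Real.cos (η + φ) ≤
      s.unmarked * x.unmarked - s.faulty * x.faulty - s.good * x.good := by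
    rw [Real.cos_add, hsu, ← hcosη]; linarith
  have hS' : Real.cos (γ + φ) ≤ Real.cos (η + φ) :=
    Real.cos_le_cos_of_nonneg_of_le_pi (by linarith) (by linarith) (by linarith)
  refine ⟨by rw [normSq_rotate hs, hn], ?_, ?_⟩
  · have h1 : Real.sin (γ + 2 * φ) = Real.sin γ + 2 * Real.sin φ * Real.cos (γ + φ) := by
      have := Real.sin_sub_sin (γ + 2 * φ) γ
      rw [show (γ + 2 * φ - γ) / 2 = φ by ring, show (γ + 2 * φ + γ) / 2 = γ + φ by ring] at this
      linarith
    have h2 := mul_le_mul_of_nonneg_left (hS'.trans hS) (mul_nonneg hβ hsin)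
    simp only [Amplitudes.rotate]
    rw [h1, hsg] at *
    linarith
  · have h1 : Real.cos (η + 2 * φ) = -Real.cos η + 2 * Real.cos φ * Real.cos (η + φ) := by
      have := Real.cos_add_cos (η + 2 * φ) η
      rw [show (η + 2 * φ + η) / 2 = η + φ by ring, show (η + 2 * φ - η) / 2 = φ by ring] at this
      linarith
    have h2 : Real.cos (γ + 2 * φ) ≤ Real.cos (η + 2 * φ) :=
      Real.cos_le_cos_of_nonneg_of_le_pi (by linarith) hle (by linarith)
    have h3 := mul_le_mul_of_nonneg_left hS hcos
    simp only [Amplitudes.rotate]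
    rw [h1, hcosη] at h2
    rw [hsu] at *
    linarith

/-! ### Bounds on the unmarked amplitude after a whole run. -/

section Run

variable {β φ : ℝ} {s : Amplitudes}

theorem Advanced.run {γ : ℝ} {x : Amplitudes} (hx : Advanced β γ x) (hs : s.normSq = 1)
    (hβ : 0 ≤ β) (hφ : 0 ≤ φ) (hsu : s.unmarked = Real.cos φ) (hsg : s.good = β * Real.sin φ)
    (hγ : 0 ≤ γ) (w : ℕ → Bool) (n : ℕ) (hle : γ + 2 * n * φ ≤ Real.pi) :
    Advanced β (γ + 2 * n * φ) (run s w x n) := by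
  induction n with
  | zero => simpa [Amplitudes.run] using hx
  | succ n ih =>
    push_cast at hle ⊢
    have h := ((ih (by linarith)).flipFaulty (w n)).rotate hs hβ hφ hsu hsg (by positivity)
      (by linarith)
    rwa [show γ + 2 * n * φ + 2 * φ = γ + 2 * (n + 1) * φ by ring] at h

/-- The final unmarked amplitude is a functional of the initial state, represented by a vector that
is itself advanced. -/
theorem exists_advanced_form_eq (hs : s.normSq = 1) (hβ : 0 ≤ β) (hφ : 0 ≤ φ)
    (hsu : s.unmarked = Real.cos φ) (hsg : s.good = β * Real.sin φ) (m : ℕ) (w : ℕ → Bool)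
    (hle : 2 * m * φ ≤ Real.pi) :
    ∃ y, Advanced β (2 * m * φ) y ∧ ∀ x, (Amplitudes.run s w x m).unmarked = form x y := by
  induction m generalizing w with
  -- The unmarked axis reads off the unmarked amplitude and has angle `0`.
  | zero => exact ⟨⟨0, 0, 1⟩, ⟨by simp [normSq], by simp, by simp⟩, by simp [Amplitudes.run, form]⟩
  | succ m ih =>
    push_cast at hle ⊢
    obtain ⟨y, hy, hxy⟩ := ih (fun i => w (i + 1)) (by linarith)
    refine ⟨flipFaulty (w 0) (rotate s y), ?_, fun x => ?_⟩
    · have h := (hy.rotate hs hβ hφ hsu hsg (by positivity) (by linarith)).flipFaulty (w 0)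
      rwa [show 2 * m * φ + 2 * φ = 2 * (m + 1) * φ by ring] at h
    · rw [run_succ_left, hxy, form_rotate, form_flipFaulty]

/-- AM–GM on the unmarked and faulty products leaves `1 - (x.good + y.good)² / 2`. -/
theorem form_le {q : ℝ} {x y : Amplitudes} (hx : x.normSq = 1) (hy : y.normSq = 1) (hq : 0 ≤ q)
    (hxq : q ≤ x.good) (hyq : q ≤ y.good) : form x y ≤ 1 - 2 * q ^ 2 := by
  simp only [normSq, form] at *
  nlinarith [sq_nonneg (x.unmarked - y.unmarked), sq_nonneg (x.faulty + y.faulty)]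

theorem abs_unmarked_run_le {κ : ℝ} (hs : s.normSq = 1) (hβ : 0 ≤ β) (hβ2 : 1 / 2 ≤ β ^ 2)
    (hφ : 0 ≤ φ) (hsu : s.unmarked = Real.cos φ) (hsg : s.good = β * Real.sin φ) (w : ℕ → Bool)
    (j : ℕ) (hle : (2 * j + 1) * φ ≤ Real.pi / 2) (hlow : -κ ≤ Real.cos ((4 * j + 1) * φ))
    (hup : Real.cos (2 * j * φ) ^ 2 ≤ κ) : |(run s w s (j + j)).unmarked| ≤ κ := by
  have hstart : Advanced β φ s := ⟨hs, hsg.ge, hsu.ge⟩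
  have hj : 0 ≤ 2 * j * φ := by positivity
  rw [abs_le]
  constructor
  · have h := (hstart.run hs hβ hφ hsu hsg hφ w (j + j) (by push_cast; linarith)).unmarked_ge
    rw [show φ + 2 * ((j + j : ℕ) : ℝ) * φ = (4 * j + 1) * φ by push_cast; ring] at h
    linarith
  · have hx := hstart.run hs hβ hφ hsu hsg hφ w j (by linarith [Real.pi_pos])
    obtain ⟨y, hy, hxy⟩ := exists_advanced_form_eq hs hβ hφ hsu hsg j (fun i => w (j + i))
      (by linarith [Real.pi_pos])
    rw [run_add, hxy]
    have hsin : 0 ≤ Real.sin (2 * j * φ) :=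
      Real.sin_nonneg_of_nonneg_of_le_pi hj (by linarith [Real.pi_pos])
    -- `x` begins at angle `φ` and `y` at `0`; the smaller sine serves as the common bound.
    have hmono : Real.sin (2 * j * φ) ≤ Real.sin (φ + 2 * j * φ) :=
      Real.sin_le_sin_of_le_of_le_pi_div_two (by linarith [Real.pi_pos]) (by linarith)
        (by linarith)
    have h := form_le hx.normSq_eq hy.normSq_eq (mul_nonneg hβ hsin)
      ((mul_le_mul_of_nonneg_left hmono hβ).trans hx.good_ge) hy.good_ge
    have h2 := mul_le_mul_of_nonneg_right hβ2 (sq_nonneg (Real.sin (2 * j * φ)))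
    rw [mul_pow] at h
    linarith [Real.sin_sq_add_cos_sq (2 * j * φ)]

end Run

/-- The starting state with `k` marked elements out of `N`. -/
noncomputable def start (N k : ℕ) : Amplitudes :=
  ⟨1 / √N, √(k - 1 : ℝ) / √N, √(N - k : ℝ) / √N⟩

/-- The state with the given amplitudes. -/
noncomputable def toState {N : ℕ} (M : Finset (Fin N)) (f : Fin N) (x : Amplitudes) : Fin N → ℂ :=
  fun i => ((if i = f then x.faulty else if i ∈ M then x.good / √(M.card - 1 : ℝ)
    else x.unmarked / √(N - M.card : ℝ) : ℝ) : ℂ)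

end Amplitudes

/-! ### Reduction of the `N`-dimensional state to three amplitudes. -/

open Amplitudes

theorem groverDiffusion_mulVec {N : ℕ} (v : Fin N → ℂ) (i : Fin N) :
    (groverDiffusion N *ᵥ v) i = 2 / N * ∑ j, v j - v i := by
  have h : ∀ j, groverDiffusion N i j * v j = 2 / N * v j - if i = j then v j else 0 := by
    intro j
    by_cases hij : i = j
    · simp only [groverDiffusion, Matrix.of_apply, if_pos hij]; ring
    · simp [groverDiffusion, hij]
  simp [Matrix.mulVec, dotProduct, h, Finset.sum_sub_distrib, Finset.mul_sum]

theorem groverFaultyQuery_mulVec {N : ℕ} {M : Finset (Fin N)} {f : Fin N} (hf : f ∈ M) (w : Bool)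
    (v : Fin N → ℂ) (i : Fin N) : (groverFaultyQuery M f w *ᵥ v) i =
      if i = f then (if w then v i else -v i) else if i ∈ M then -v i else v i := by
  by_cases hi : i = f
  · subst hi
    cases w <;> simp [groverFaultyQuery, groverQuery, Matrix.mulVec_diagonal, hf]
  · by_cases hM : i ∈ M <;>
      cases w <;> simp [groverFaultyQuery, groverQuery, Matrix.mulVec_diagonal, hi, hM]

theorem sum_ite_faulty_marked {N : ℕ} {M : Finset (Fin N)} {f : Fin N} (hf : f ∈ M) (a b c : ℝ) :
    ∑ i, (if i = f then a else if i ∈ M then b else c) =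
      a + (M.card - 1) * b + (N - M.card) * c := by
  have h : ∀ i, (if i = f then a else if i ∈ M then b else c) =
      (if i = f then a - b else 0) + (if i ∈ M then b - c else 0) + c := by
    intro i
    by_cases hi : i = f
    · subst hi; simp [hf]
    · by_cases hM : i ∈ M <;> simp [hi, hM]
  simp only [h, Finset.sum_add_distrib, Finset.sum_ite_eq', Finset.sum_ite_mem, Finset.mem_univ,
    if_true, Finset.sum_const, Finset.card_univ, Fintype.card_fin, Finset.univ_inter, nsmul_eq_mul]
  ring

section State

variable {N : ℕ} {M : Finset (Fin N)} {f : Fin N}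

theorem groverStart_eq_toState (hM : 2 ≤ M.card) (hN : M.card < N) :
    groverStart N = toState M f (start N M.card) := by
  have h1 : (0 : ℝ) < M.card - 1 := by
    have : (2 : ℝ) ≤ M.card := by exact_mod_cast hM
    linarith
  have h2 : (0 : ℝ) < N - M.card := by
    have : (M.card : ℝ) < N := by exact_mod_cast hN
    linarith
  have h1' := (Real.sqrt_pos.2 h1).ne'
  have h2' := (Real.sqrt_pos.2 h2).ne'
  funext i
  simp only [groverStart, toState, start, Complex.ofReal_inj]
  split_ifs <;> field_simp

theorem step_toState (hf : f ∈ M) (hM : 2 ≤ M.card) (hN : M.card < N) (w : Bool)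
    (x : Amplitudes) : groverDiffusion N *ᵥ (groverFaultyQuery M f w *ᵥ toState M f x) =
      toState M f (rotate (start N M.card) (flipFaulty w x)) := by
  have h1 : (0 : ℝ) < M.card - 1 := by
    have : (2 : ℝ) ≤ M.card := by exact_mod_cast hM
    linarith
  have h2 : (0 : ℝ) < N - M.card := by
    have : (M.card : ℝ) < N := by exact_mod_cast hN
    linarith
  have h0 : (0 : ℝ) < N := by linarith
  set y := flipFaulty w x with hy
  have hq : groverFaultyQuery M f w *ᵥ toState M f x = fun i =>
      ((if i = f then -y.faulty else if i ∈ M then -(y.good / √(M.card - 1 : ℝ))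
        else y.unmarked / √(N - M.card : ℝ) : ℝ) : ℂ) := by
    funext i
    rw [groverFaultyQuery_mulVec hf]
    by_cases hi : i = f
    · cases w <;> simp [toState, hi, hy, flipFaulty]
    · by_cases hiM : i ∈ M <;> simp [toState, hi, hiM, hy, flipFaulty]
  funext i
  rw [hq, groverDiffusion_mulVec, ← Complex.ofReal_sum, sum_ite_faulty_marked hf]
  have ha := Real.sq_sqrt h1.le
  have hb := Real.sq_sqrt h2.le
  have hc := Real.sq_sqrt h0.le
  have ha' := Real.sqrt_pos.2 h1
  have hb' := Real.sqrt_pos.2 h2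
  have hc' := Real.sqrt_pos.2 h0
  simp only [toState, rotate, start]
  set a := √(M.card - 1 : ℝ)
  set b := √(N - M.card : ℝ)
  set c := √(N : ℝ)
  rw [← ha, ← hb]
  have hNc : (N : ℂ) = ((c ^ 2 : ℝ) : ℂ) := by rw [hc]; simp
  rw [hNc]
  norm_cast
  split_ifs <;> field_simp <;> ring

theorem groverState_eq_toState (hf : f ∈ M) (hM : 2 ≤ M.card) (hN : M.card < N) (w : ℕ → Bool)
    (t : ℕ) : groverState M f t (fun i => w i) =
      toState M f (run (start N M.card) w (start N M.card) t) := by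
  induction t with
  | zero => exact groverStart_eq_toState hM hN
  | succ t ih =>
    rw [run, ← step_toState hf hM hN, ← ih]
    rfl

theorem probMeasuredIn_toState (hf : f ∈ M) (hM : 2 ≤ M.card) (x : Amplitudes) :
    probMeasuredIn M (toState M f x) = x.faulty ^ 2 + x.good ^ 2 := by
  have h1 : (0 : ℝ) < M.card - 1 := by
    have : (2 : ℝ) ≤ M.card := by exact_mod_cast hM
    linarith
  have h : ∀ i ∈ M.erase f, ‖toState M f x i‖ ^ 2 = x.good ^ 2 / (M.card - 1 : ℝ) := by
    intro i hi
    rw [Finset.mem_erase] at hi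
    simp only [toState, if_neg hi.1, if_pos hi.2, Complex.norm_real, Real.norm_eq_abs, sq_abs,
      div_pow, Real.sq_sqrt h1.le]
  rw [probMeasuredIn, ← Finset.add_sum_erase _ _ hf, Finset.sum_congr rfl h, Finset.sum_const,
    Finset.card_erase_of_mem hf, nsmul_eq_mul, Nat.cast_sub (by omega), Nat.cast_one,
    mul_div_cancel₀ _ h1.ne']
  simp [toState]

end State

/-! ### Choice of the number of steps. -/

theorem Amplitudes.normSq_start {N k : ℕ} (hk : 1 ≤ k) (hN : k < N) : (start N k).normSq = 1 := by
  have h1 : (1 : ℝ) ≤ k := by exact_mod_cast hk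
  have h2 : (k : ℝ) < N := by exact_mod_cast hN
  simp only [normSq, start, div_pow]
  rw [Real.sq_sqrt (by linarith), Real.sq_sqrt (by linarith), Real.sq_sqrt (by linarith)]
  have h3 : (N : ℝ) ≠ 0 := by linarith
  field_simp
  ring

/-- At the left end, `(1 - sin (0.08π)) / 2 ≤ (1 - 0.24) / 2 = 0.38 ≤ sin (π/8)`. -/
theorem cos_sq_le_sin_pi_div_eight {x : ℝ} (h1 : 29 / 100 * Real.pi ≤ x) (h2 : x ≤ Real.pi / 2) :
    Real.cos x ^ 2 ≤ Real.sin (Real.pi / 8) := by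
  have hπ := Real.pi_gt_d2
  have hπ' := Real.pi_lt_d2
  have h3 : Real.cos (2 * x) ≤ Real.cos (Real.pi / 2 + 2 / 25 * Real.pi) :=
    Real.cos_le_cos_of_nonneg_of_le_pi (by positivity) (by linarith) (by linarith)
  rw [add_comm, Real.cos_add_pi_div_two] at h3
  have h4 : (0.24 : ℝ) ≤ Real.sin (2 / 25 * Real.pi) := by
    refine le_trans ?_ (Real.sin_gt_sub_cube (x := 2 / 25 * Real.pi) (by positivity)).le
    have h5 : (2 / 25 * Real.pi) ^ 3 ≤ (0.252 : ℝ) ^ 3 := by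
      gcongr; linarith
    norm_num at h5 ⊢
    linarith
  have h6 : (0.38 : ℝ) ≤ Real.sin (Real.pi / 8) := by
    refine le_trans ?_ (Real.sin_gt_sub_cube (x := Real.pi / 8) (by positivity)).le
    have h5 : (Real.pi / 8) ^ 3 ≤ (0.394 : ℝ) ^ 3 := by
      gcongr; linarith
    norm_num at h5 ⊢
    linarith
  rw [Real.cos_sq]
  linarith

/-- For a suitable number of steps, Grover's algorithm succeeds whatever the fault pattern. -/
theorem exists_forall_pattern_le_probMeasuredIn {N k : ℕ} (hk : 2 ≤ k)
    (hkN : (k : ℝ) ≤ 1 / 10000 * N) :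
    ∃ t : ℕ, (t : ℝ) ≤ 1 * √((N : ℝ) / k) ∧
      ∀ (M : Finset (Fin N)) (f : Fin N), M.card = k → f ∈ M → ∀ w : Fin t → Bool,
        Real.cos (Real.pi / 8) ^ 2 ≤ probMeasuredIn M (groverState M f t w) := by
  have hk2 : (2 : ℝ) ≤ k := by exact_mod_cast hk
  have hN0 : (0 : ℝ) < N := by linarith
  have hlt : k < N := by
    have : (k : ℝ) < N := by linarith
    exact_mod_cast this
  have hπ := Real.pi_gt_d2
  have hπ' := Real.pi_lt_d2
  have hr : √((k : ℝ) / N) ≤ 1 / 100 := by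
    rw [Real.sqrt_le_left (by norm_num), div_le_iff₀ hN0]
    linarith
  have hr0 : 0 < √((k : ℝ) / N) := Real.sqrt_pos.2 (by positivity)
  set φ := Real.arcsin √((k : ℝ) / N) with hφdef
  have hsin : Real.sin φ = √((k : ℝ) / N) := Real.sin_arcsin (by linarith) (by linarith)
  have hφ0 : 0 < φ := Real.arcsin_pos.2 hr0
  have hφ1 : φ ≤ Real.pi / 200 := by
    have h := Real.mul_le_sin hφ0.le (Real.arcsin_le_pi_div_two _)
    rw [hsin] at h
    have h' : 2 / Real.pi * φ ≤ 1 / 100 := h.trans hr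
    rw [div_mul_eq_mul_div, div_le_iff₀ Real.pi_pos] at h'
    linarith
  have hcos : Real.cos φ = √(N - k : ℝ) / √N := by
    rw [hφdef, Real.cos_arcsin, Real.sq_sqrt (by positivity), ← Real.sqrt_div' _ hN0.le,
      sub_div, div_self hN0.ne']
  -- Rounding up costs at most `2φ`, so `(4j + 1)φ ≤ 0.58π + 5φ ≤ 0.605π`, below the `0.625π` at
  -- which the cosine reaches `-sin (π/8)`.
  set j := ⌈29 / 100 * Real.pi / (2 * φ)⌉₊
  have hj1 : 29 / 100 * Real.pi ≤ 2 * j * φ := by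
    have h := Nat.le_ceil (29 / 100 * Real.pi / (2 * φ))
    rw [div_le_iff₀ (by positivity)] at h
    linarith
  have hj2 : 2 * j * φ ≤ 29 / 100 * Real.pi + 2 * φ := by
    have h := (Nat.ceil_lt_add_one (a := 29 / 100 * Real.pi / (2 * φ)) (by positivity)).le
    rw [← sub_le_iff_le_add, le_div_iff₀ (by positivity)] at h
    linarith
  refine ⟨j + j, ?_, ?_⟩
  · rw [one_mul, ← inv_div, Real.sqrt_inv, ← one_div, le_div_iff₀ hr0, ← hsin]
    have h := mul_le_mul_of_nonneg_left (Real.sin_le hφ0.le) (Nat.cast_nonneg (α := ℝ) (j + j))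
    push_cast at h ⊢
    linarith
  · rintro M f rfl hf w
    obtain ⟨w, rfl⟩ : ∃ w' : ℕ → Bool, w = fun i : Fin (j + j) => w' i :=
      ⟨fun n => if h : n < j + j then w ⟨n, h⟩ else false, by funext i; simp⟩
    have hs := normSq_start (by omega : 1 ≤ M.card) hlt
    -- Here `β² = (k-1)/k`, and `β² ≥ 1/2` is exactly `k ≥ 2`.
    have habs := abs_unmarked_run_le (s := start N M.card) (φ := φ)
      (β := √(M.card - 1 : ℝ) / √M.card) (κ := Real.sin (Real.pi / 8)) hs (by positivity)
      (by
        rw [div_pow, Real.sq_sqrt (by linarith), Real.sq_sqrt (by linarith),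
          le_div_iff₀ (by linarith)]
        linarith)
      hφ0.le hcos.symm
      (by
        rw [hsin, Real.sqrt_div' _ hN0.le]
        have := (Real.sqrt_pos.2 (by linarith : (0 : ℝ) < M.card)).ne'
        simp only [start]
        field_simp)
      w j (by linarith)
      (by
        rw [← Real.cos_add_pi_div_two]
        exact Real.cos_le_cos_of_nonneg_of_le_pi (by positivity) (by linarith) (by linarith))
      (cos_sq_le_sin_pi_div_eight hj1 (by linarith))
    rw [groverState_eq_toState hf hk hlt, probMeasuredIn_toState hf hk]
    set x := run (start N M.card) w (start N M.card) (j + j) with hx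
    have hnorm : x.normSq = 1 := by
      have h : ∀ n, (run (start N M.card) w (start N M.card) n).normSq = 1 := by
        intro n
        induction n with
        | zero => exact hs
        | succ n ih =>
          rw [run, normSq_rotate hs, ← ih]
          cases w n <;> simp [normSq, flipFaulty]
      exact h _
    have hsq : x.unmarked ^ 2 ≤ Real.sin (Real.pi / 8) ^ 2 := by
      rw [← sq_abs]
      gcongr
    rw [normSq] at hnorm
    linarith [Real.sin_sq_add_cos_sq (Real.pi / 8)]

/-! ### Averaging over fault patterns. -/

theorem faultPatternProb_nonneg {p : ℝ} (hp0 : 0 ≤ p) (hp1 : p ≤ 1) {t : ℕ} (w : Fin t → Bool) :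
    0 ≤ faultPatternProb p w :=
  Finset.prod_nonneg fun s _ => by split_ifs <;> linarith

theorem sum_faultPatternProb (p : ℝ) (t : ℕ) : ∑ w : Fin t → Bool, faultPatternProb p w = 1 := by
  have h := Finset.prod_univ_sum (fun _ : Fin t => (Finset.univ : Finset Bool))
    (fun _ b => if b then p else 1 - p)
  rw [Fintype.piFinset_univ] at h
  simp only [faultPatternProb, ← h]
  simp

theorem le_groverSuccessProb {N t : ℕ} {M : Finset (Fin N)} {f : Fin N} {p q : ℝ} (hp0 : 0 ≤ p)
    (hp1 : p ≤ 1) (h : ∀ w : Fin t → Bool, q ≤ probMeasuredIn M (groverState M f t w)) :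
    q ≤ groverSuccessProb M f p t := by
  calc q = ∑ w : Fin t → Bool, faultPatternProb p w * q := by
        rw [← Finset.sum_mul, sum_faultPatternProb, one_mul]
    _ ≤ _ := Finset.sum_le_sum fun w _ =>
        mul_le_mul_of_nonneg_left (h w) (faultPatternProb_nonneg hp0 hp1 w)

theorem le_groverSuccessProbAtMostOneFault {N t : ℕ} {M : Finset (Fin N)} {f : Fin N} {p q : ℝ}
    (hp0 : 0 ≤ p) (hp1 : p ≤ 1) (hpos : 0 < atMostOneFaultProb p t)
    (h : ∀ w : Fin t → Bool, faultCount w ≤ 1 → q ≤ probMeasuredIn M (groverState M f t w)) :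
    q ≤ groverSuccessProbAtMostOneFault M f p t := by
  rw [groverSuccessProbAtMostOneFault, le_div_iff₀ hpos, mul_comm, atMostOneFaultProb,
    Finset.sum_mul]
  exact Finset.sum_le_sum fun w hw =>
    mul_le_mul_of_nonneg_left (h w (Finset.mem_filter.1 hw).2) (faultPatternProb_nonneg hp0 hp1 w)

theorem theorem1 :
    ∃ C δ : ℝ, 0 < C ∧ 0 < δ ∧
      -- at least three marked elements
      (∀ N k : ℕ, 3 ≤ k → (k : ℝ) ≤ δ * N →
        ∃ t : ℕ, (t : ℝ) ≤ C * Real.sqrt ((N : ℝ) / k) ∧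
          ∀ (M : Finset (Fin N)) (f : Fin N), M.card = k → f ∈ M →
            ∀ p : ℝ, 0 ≤ p → p ≤ 1 →
              Real.cos (Real.pi / 8) ^ 2 ≤ groverSuccessProb M f p t) ∧
      -- two marked elements, under the promise that at most one fault occurs
      (∀ N : ℕ, (2 : ℝ) ≤ δ * N →
        ∃ t : ℕ, (t : ℝ) ≤ C * Real.sqrt ((N : ℝ) / 2) ∧
          ∀ (M : Finset (Fin N)) (f : Fin N), M.card = 2 → f ∈ M →
            (∀ w : Fin t → Bool, faultCount w ≤ 1 →
              Real.cos (Real.pi / 8) ^ 2 ≤ probMeasuredIn M (groverState M f t w)) ∧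
            (∀ p : ℝ, 0 ≤ p → p ≤ 1 → 0 < atMostOneFaultProb p t →
              Real.cos (Real.pi / 8) ^ 2 ≤ groverSuccessProbAtMostOneFault M f p t)) ∧
      -- two marked elements, any number of faults
      (∀ N : ℕ, (2 : ℝ) ≤ δ * N →
        ∃ t : ℕ, (t : ℝ) ≤ C * Real.sqrt ((N : ℝ) / 2) ∧
          ∀ (M : Finset (Fin N)) (f : Fin N), M.card = 2 → f ∈ M →
            ∀ p : ℝ, 0 ≤ p → p ≤ 1 →
              Real.cos (17 * Real.pi / 100) ^ 2 ≤ groverSuccessProb M f p t) := by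
  refine ⟨1, 1 / 10000, one_pos, by norm_num, fun N k hk hkN => ?_, fun N hN => ?_, fun N hN => ?_⟩
  · obtain ⟨t, ht, h⟩ := exists_forall_pattern_le_probMeasuredIn (by omega : 2 ≤ k) hkN
    exact ⟨t, ht, fun M f hM hf p hp0 hp1 => le_groverSuccessProb hp0 hp1 (h M f hM hf)⟩
  · obtain ⟨t, ht, h⟩ := exists_forall_pattern_le_probMeasuredIn le_rfl (by exact_mod_cast hN)
    exact ⟨t, by exact_mod_cast ht, fun M f hM hf => ⟨fun w _ => h M f hM hf w,
      fun p hp0 hp1 hpos => le_groverSuccessProbAtMostOneFault hp0 hp1 hpos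
        fun w _ => h M f hM hf w⟩⟩
  -- The bound `cos² (π/8)` holds here too and is stronger, as `1/8 < 0.17`.
  · obtain ⟨t, ht, h⟩ := exists_forall_pattern_le_probMeasuredIn le_rfl (by exact_mod_cast hN)
    refine ⟨t, by exact_mod_cast ht, fun M f hM hf p hp0 hp1 =>
      le_trans ?_ (le_groverSuccessProb hp0 hp1 (h M f hM hf))⟩
    have hπ := Real.pi_pos
    have h0 : 0 ≤ Real.cos (17 * Real.pi / 100) :=
      Real.cos_nonneg_of_neg_pi_div_two_le_of_le (by linarith) (by linarith)
    gcongr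
    exact Real.cos_le_cos_of_nonneg_of_le_pi (by positivity) (by linarith) (by linarith)
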